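/- Let $v>2$, $\omega>0$, $\beta\ge 0$, $\alpha>0$, $\gamma\ge-\alpha$, and let $\{\varepsilon_t\}_{t\in\mathbb Z}$ be an i.i.d. sequence of random variables on a probability space such that $\varepsilon_t/s$ has Student's $t$ distribution with $v$ degrees of freedom, where $s>0$ is a fixed scale ($s=1$ is the classical Student distribution, $s=\sqrt{(v-2)/v}$ the one with unit variance). Consider the Beta-$t$-GARCH model $$y_t=\sqrt{f_t}\,\varepsilon_t,\qquad f_{t+1}=\omega+\beta f_t+(\alpha+\gamma d_t)\frac{(v+1)y_t^2}{(v-2)+y_t^2/f_t},\qquad t\in\mathbb Z,$$ where $d_t=1$ if $y_t\le 0$ and $d_t=0$ otherwise. Equivalently, $f_{t+1}=\omega+f_t c_t$ with $$c_t=\beta+(\alpha+\gamma d_t)(v+1)\frac{\varepsilon_t^2}{v-2+\varepsilon_t^2},\qquad d_t=\mathbf 1\{\varepsilon_t\le 0\}.$$ A solution is a sequence $\{f_t\}_{t\in\mathbb Z}$ of random variables on the same probability space that takes values in $[0,\infty)$ almost surely and satisfies these equations almost surely for every $t\in\mathbb Z$. Then the model admits a solution $\{f_t\}_{t\in\mathbb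 Z}$ that is (strictly) stationary and ergodic, and that is unique among such solutions up to almost sure equality, if and only if $$E\log c_t<0 ,$$ where the expectation, which does not depend on $t$, is taken in $[-\infty,\infty)$ with $\log 0=-\infty$. -/

import Mathlib

open MeasureTheory ProbabilityTheory

noncomputable section

/-- The density of Student's `t` distribution with `v` degrees of freedom. -/
def studentTPDF (v x : ℝ) : ℝ :=
  Real.Gamma ((v + 1) / 2) / (Real.sqrt (v * Real.pi) * Real.Gamma (v / 2))
    * (1 + x ^ 2 / v) ^ (-((v + 1) / 2))

/-- Student's `t` distribution with `v` degrees of freedom, as a measure on `ℝ`. -/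
def studentTMeasure (v : ℝ) : Measure ℝ :=
  volume.withDensity fun x => ENNReal.ofReal (studentTPDF v x)

/-- `ε` is an i.i.d. sequence, indexed by `ℤ`, of random variables `s * T` where `T` has Student's
`t` distribution with `v` degrees of freedom. The scale `s = 1` gives the classical distribution,
the scale `s = √((v - 2) / v)` the one with unit variance. -/
structure IsIIDStudentT {Ω : Type*} [MeasurableSpace Ω] (μ : Measure Ω) (v s : ℝ)
    (ε : ℤ → Ω → ℝ) : Prop where
  measurable : ∀ t, Measurable (ε t)
  indep : iIndepFun ε μ
  law : ∀ t, μ.map (ε t) = (studentTMeasure v).map fun x => s * x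

/-- The left shift on two-sided real sequences. -/
def seqShift (x : ℤ → ℝ) : ℤ → ℝ := fun t => x (t + 1)

/-- A two-sided real process is (strictly) stationary and ergodic if the shift preserves its law on
the sequence space and is ergodic for it. (`Ergodic` includes preservation of the measure.) -/
structure IsStationaryErgodic {Ω : Type*} [MeasurableSpace Ω] (μ : Measure Ω)
    (f : ℤ → Ω → ℝ) : Prop where
  measurable : ∀ t, Measurable (f t)
  ergodic : Ergodic seqShift (μ.map fun w t => f t w)

/-- The dummy variable: `1` at nonpositive arguments and `0` at positive ones. -/
def leverage (x : ℝ) : ℝ := if x ≤ 0 then 1 else 0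

/-- The right-hand side of the Beta-`t`-GARCH updating equation: the value of `f_{t+1}` as a function
of `f = f_t` and of the observation `y = y_t`. -/
def betaTGarchUpdate (ω β α γ v f y : ℝ) : ℝ :=
  ω + β * f + (α + γ * leverage y) * ((v + 1) * y ^ 2 / ((v - 2) + y ^ 2 / f))

/-- The process `f` solves the Beta-`t`-GARCH model driven by `ε`: it takes values in `[0, ∞)` and
satisfies the updating equation with the observations `y_t = √(f_t) ε_t`, almost surely at every
`t ∈ ℤ`. (If `ω > 0`, `β ≥ 0`, `α > 0`, `γ ≥ -α` and `v > 2`, then the equation at `t - 1` gives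
`f_t ≥ ω > 0` almost surely, so that the division by `f_t` is a genuine one.) -/
structure IsBetaTGarchSolution {Ω : Type*} [MeasurableSpace Ω] (μ : Measure Ω)
    (ω β α γ v : ℝ) (ε f : ℤ → Ω → ℝ) : Prop where
  nonneg : ∀ t, ∀ᵐ w ∂μ, 0 ≤ f t w
  update : ∀ t, ∀ᵐ w ∂μ,
    f (t + 1) w = betaTGarchUpdate ω β α γ v (f t w) (Real.sqrt (f t w) * ε t w)

/-- The random coefficient `c_t = β + (α + γ d_t) (v + 1) b_t`, `b_t = ε_t² / (v - 2 + ε_t²)`, as a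
function of `e = ε_t`. As `y_t = √(f_t) ε_t` with `f_t > 0`, the dummy `d_t` is that of `ε_t`. -/
def betaTGarchCoeff (β α γ v e : ℝ) : ℝ :=
  β + (α + γ * leverage e) * (v + 1) * (e ^ 2 / (v - 2 + e ^ 2))

/-- The expectation of `log X` for a nonnegative random variable `X`, as an extended real number:
the integral of the positive part minus that of the negative part, where `log 0 = -∞`. -/
def expectLog {Ω : Type*} [MeasurableSpace Ω] (μ : Measure Ω) (X : Ω → ℝ) : EReal :=
  ((∫⁻ w, (ENNReal.log (ENNReal.ofReal (X w))).toENNReal ∂μ : ENNReal) : EReal)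
    - ((∫⁻ w, (-ENNReal.log (ENNReal.ofReal (X w))).toENNReal ∂μ : ENNReal) : EReal)

end

/-! On `f ≥ 0` the model is the affine recursion `f_{t+1} = ω + c_t f_t` with bounded, nonnegative,
i.i.d. `c_t`. If `E log c_t < 0`, the strong law makes the products `c_{t-1} ⋯ c_{t-n}` decay
geometrically (`ae_exists_prod_le_pow`), so the series `affineSolution` converges almost surely and
solves the recursion. It is a shift-equivariant function of the noise, hence a factor of a Bernoulli
shift, which is ergodic (`ergodic_seqShift_infinitePi`). Two stationary solutions differ at time `t`
by such a product times their difference at `t - n`: a null sequence times a tight one, so zero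
(`ae_eq_zero_of_abs_le_mul`). Conversely, along a stationary solution `log f_{t+1} - log f_t = log
(ω / f_t + c_t) > log c_t`. If `E log c_t ≥ 0`, the left side is integrable, with mean zero by
`integral_sub_eq_zero_of_identDistrib`, which contradicts the strict inequality. -/

open Filter Topology
open scoped symmDiff

/-! ### Ergodicity of the two-sided Bernoulli shift. -/

lemma measurable_seqShift : Measurable seqShift :=
  measurable_pi_lambda _ fun t => measurable_pi_apply (t + 1)

lemma seqShift_iterate_apply (n : ℕ) (x : ℤ → ℝ) (t : ℤ) : seqShift^[n] x t = x (t + n) := by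
  induction n generalizing t with
  | zero => simp
  | succ n ih =>
    rw [Function.iterate_succ_apply', seqShift, ih]
    push_cast
    congr 1
    ring

lemma measurePreserving_seqShift_infinitePi (ν : Measure ℝ) [IsProbabilityMeasure ν] :
    MeasurePreserving seqShift (Measure.infinitePi fun _ : ℤ => ν)
      (Measure.infinitePi fun _ : ℤ => ν) :=
  ⟨measurable_seqShift, Measure.map_infinitePi_infinitePi_of_inj
    (P := fun _ : ℤ => ν) (add_left_injective (1 : ℤ))⟩

lemma exists_disjoint_image_add (S : Finset ℤ) :
    ∃ n : ℕ, Disjoint S (S.image fun i => i + (n : ℤ)) := by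
  -- This `n` exceeds `2|i|` for all `i ∈ S`, hence `|i| + |j|` for all `i, j ∈ S`, so `i = j + n`
  -- is impossible.
  refine ⟨∑ i ∈ S, 2 * i.natAbs + 1, Finset.disjoint_left.2 fun i hi hi' => ?_⟩
  obtain ⟨j, hj, hji⟩ := Finset.mem_image.1 hi'
  have h1 := Finset.single_le_sum (f := fun i : ℤ => 2 * i.natAbs) (fun _ _ => Nat.zero_le _) hi
  have h2 := Finset.single_le_sum (f := fun i : ℤ => 2 * i.natAbs) (fun _ _ => Nat.zero_le _) hj
  beta_reduce at h1 h2 hji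
  omega

/-- A cylinder event is independent of some of its translates. -/
lemma exists_measureReal_inter_seqShift_preimage (ν : Measure ℝ) [IsProbabilityMeasure ν]
    {C : Set (ℤ → ℝ)} (hC : C ∈ measurableCylinders fun _ : ℤ => ℝ) :
    ∃ n : ℕ, (Measure.infinitePi fun _ : ℤ => ν).real (C ∩ seqShift^[n] ⁻¹' C)
      = (Measure.infinitePi fun _ : ℤ => ν).real C ^ 2 := by
  obtain ⟨S, B, hB, rfl⟩ := (mem_measurableCylinders _).1 hC
  obtain ⟨n, hn⟩ := exists_disjoint_image_add S
  refine ⟨n, ?_⟩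
  set P := Measure.infinitePi fun _ : ℤ => ν
  have hind : iIndepFun (fun (i : ℤ) (x : ℤ → ℝ) => x i) P :=
    iIndepFun_infinitePi (X := fun _ (x : ℝ) => x) fun _ => measurable_id
  have h := hind.indepFun_finset S _ hn fun i => measurable_pi_apply i
  -- Relabelling the translated coordinates by `S` turns the shifted cylinder into an event over `S
  -- + n`.
  let r : ((S.image fun i => i + (n : ℤ)) → ℝ) → (S → ℝ) :=
    fun y i => y ⟨i + n, Finset.mem_image_of_mem _ i.2⟩
  have hr : Measurable r := measurable_pi_lambda _ fun i => measurable_pi_apply _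
  have key := h.measure_inter_preimage_eq_mul B (r ⁻¹' B) hB (hr hB)
  have e1 : (fun (a : ℤ → ℝ) (i : S) => a i) ⁻¹' B = cylinder S B := rfl
  have e2 : (fun (a : ℤ → ℝ) (i : (S.image fun i => i + (n : ℤ))) => a i) ⁻¹' (r ⁻¹' B)
      = seqShift^[n] ⁻¹' cylinder S B := by
    ext x
    have : (fun i : S => x (i + n)) = S.restrict (seqShift^[n] x) := by
      funext i
      exact (seqShift_iterate_apply n x i).symm
    change (fun i : S => x (i + n)) ∈ B ↔ S.restrict (seqShift^[n] x) ∈ B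
    rw [this]
  rw [e1, e2] at key
  rw [measureReal_def, key, ENNReal.toReal_mul,
    ((measurePreserving_seqShift_infinitePi ν).iterate n).measure_preimage
      (hB.cylinder S).nullMeasurableSet, sq]
  rfl

/-- The two-sided Bernoulli shift is ergodic. -/
theorem ergodic_seqShift_infinitePi (ν : Measure ℝ) [IsProbabilityMeasure ν] :
    Ergodic seqShift (Measure.infinitePi fun _ : ℤ => ν) := by
  refine ⟨measurePreserving_seqShift_infinitePi ν, ⟨fun s hs hinv => ?_⟩⟩
  set P := Measure.infinitePi fun _ : ℤ => ν with hP
  have hinv' : ∀ n : ℕ, seqShift^[n] ⁻¹' s = s := fun n => by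
    induction n with
    | zero => rfl
    | succ n ih => rw [Function.iterate_succ, Set.preimage_comp, ih, hinv]
  -- A cylinder `C` approximates `s` within `δ`, and by invariance so does its translate `C'`.
  -- Replacing `s` by `C ∩ C'`, of measure `P(C)²`, costs `2δ`; replacing `P(C)²` by `P(s)²` costs
  -- another `2δ`.
  have hle : ∀ δ : ℝ, 0 < δ → |P.real s - P.real s ^ 2| ≤ 4 * δ := by
    intro δ hδ
    obtain ⟨C, hC, hCs⟩ := exists_measure_symmDiff_lt_of_generateFrom_isSetRing (μ := P)
      (isSetRing_measurableCylinders (α := fun _ : ℤ => ℝ))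
      ⟨{Set.univ}, Set.countable_singleton _,
        Set.singleton_subset_iff.2 (univ_mem_measurableCylinders _), by simp⟩
      generateFrom_measurableCylinders.symm hs (ENNReal.ofReal_pos.2 hδ)
    have hCm : MeasurableSet C := MeasurableSet.of_mem_measurableCylinders hC
    have hCs' : P.real (C ∆ s) ≤ δ := by
      rw [measureReal_def]
      exact ENNReal.toReal_le_of_le_ofReal hδ.le hCs.le
    obtain ⟨n, hn⟩ := exists_measureReal_inter_seqShift_preimage ν hC
    have hpres := (measurePreserving_seqShift_infinitePi ν).iterate n
    set C' := seqShift^[n] ⁻¹' C with hC'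
    have hCm' : MeasurableSet C' := hpres.measurable hCm
    have hCs2 : P.real (C' ∆ s) ≤ δ := by
      have : C' ∆ s = seqShift^[n] ⁻¹' (C ∆ s) := by
        rw [Set.preimage_symmDiff, hinv' n]
      rw [this, measureReal_def, hpres.measure_preimage (hCm.symmDiff hs).nullMeasurableSet]
      exact hCs'
    have h1 := abs_measureReal_sub_le_measureReal_symmDiff (μ := P)
      hCm.nullMeasurableSet hs.nullMeasurableSet
    have h2 := abs_measureReal_sub_le_measureReal_symmDiff (μ := P)
      (hCm.inter hCm').nullMeasurableSet hs.nullMeasurableSet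
    have h3 : P.real ((C ∩ C') ∆ s) ≤ P.real (C ∆ s) + P.real (C' ∆ s) := by
      refine (measureReal_mono ?_).trans (measureReal_union_le _ _)
      intro x hx
      simp only [Set.mem_symmDiff, Set.mem_inter_iff, Set.mem_union] at hx ⊢
      tauto
    rw [hn] at h2
    have b1 : P.real C ≤ 1 := measureReal_le_one
    have b2 : P.real s ≤ 1 := measureReal_le_one
    have b3 : 0 ≤ P.real C := measureReal_nonneg
    have b4 : 0 ≤ P.real s := measureReal_nonneg
    have h4 : |P.real C ^ 2 - P.real s ^ 2| ≤ 2 * δ := by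
      rw [sq_sub_sq, abs_mul]
      exact mul_le_mul (by rw [abs_of_nonneg (by positivity)]; linarith) (h1.trans hCs')
        (abs_nonneg _) (by norm_num)
    rw [abs_le] at *
    constructor <;> linarith [h2.1, h2.2, h4.1, h4.2]
  have h0 : P.real s - P.real s ^ 2 = 0 := by
    by_contra hne
    have := hle _ (div_pos (abs_pos.2 hne) (by norm_num : (0 : ℝ) < 8))
    linarith [abs_pos.2 hne]
  rw [eventuallyConst_set']
  have h1 : P.real s * (1 - P.real s) = 0 := by linear_combination h0
  rcases mul_eq_zero.1 h1 with h | h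
  · left
    exact ae_eq_empty.2 ((measureReal_eq_zero_iff).1 h)
  · right
    refine ae_eq_univ.2 ((prob_compl_eq_zero_iff hs).2 ?_)
    have : P.real s = 1 := by linarith
    rw [measureReal_def] at this
    exact (ENNReal.toReal_eq_one_iff _).1 this

/-! ### Integrals of logarithms with values in the extended reals. -/

section Log

variable {Ω : Type*} [MeasurableSpace Ω] {μ : Measure Ω}

/-- An integrable difference of two identically distributed variables has mean zero, even if the
variables themselves are not integrable. -/
lemma integral_sub_eq_zero_of_identDistrib [IsProbabilityMeasure μ] {X Y : Ω → ℝ}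
    (h : IdentDistrib X Y μ μ) (hint : Integrable (fun w => Y w - X w) μ) :
    ∫ w, (Y w - X w) ∂μ = 0 := by
  -- Clamping to `[-n, n]` makes both variables integrable with equal means. As `φ n` is
  -- 1-Lipschitz, `|Y - X|` dominates the clamped differences.
  let φ : ℕ → ℝ → ℝ := fun n x => max (-(n : ℝ)) (min x n)
  have hφm : ∀ n, Measurable (φ n) := fun n => by fun_prop
  have hφb : ∀ n x, ‖φ n x‖ ≤ n := fun n x => by
    have hn : (0 : ℝ) ≤ n := n.cast_nonneg
    rw [Real.norm_eq_abs, abs_le]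
    exact ⟨le_max_left _ _, max_le (by linarith) (min_le_right _ _)⟩
  have hφl : ∀ n x y, |φ n y - φ n x| ≤ |y - x| := fun n x y =>
    (abs_max_sub_max_le_max _ _ _ _).trans <| by
      rw [sub_self, abs_zero, max_eq_right (abs_nonneg _)]
      refine (abs_min_sub_min_le_max _ _ _ _).trans ?_
      rw [sub_self, abs_zero, max_eq_left (abs_nonneg _)]
  have hφt : ∀ x, ∀ᶠ n : ℕ in atTop, φ n x = x := fun x => by
    filter_upwards [eventually_ge_atTop ⌈|x|⌉₊] with n hn
    have := abs_le.1 ((Nat.le_ceil _).trans (Nat.cast_le.2 hn) : |x| ≤ n)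
    simp only [φ]
    rw [min_eq_left this.2, max_eq_right this.1]
  have hmeas : ∀ {Z : Ω → ℝ} n, AEMeasurable Z μ → Integrable (fun w => φ n (Z w)) μ :=
    fun {Z} n hZ => Integrable.of_bound ((hφm n).comp_aemeasurable hZ).aestronglyMeasurable n
      (ae_of_all _ fun w => hφb n _)
  have hzero : ∀ n, ∫ w, (φ n (Y w) - φ n (X w)) ∂μ = 0 := fun n => by
    rw [integral_sub (hmeas n h.aemeasurable_snd) (hmeas n h.aemeasurable_fst), sub_eq_zero]
    exact ((h.comp (hφm n)).integral_eq).symm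
  have hlim : Tendsto (fun n => ∫ w, (φ n (Y w) - φ n (X w)) ∂μ) atTop
      (𝓝 (∫ w, (Y w - X w) ∂μ)) := by
    refine tendsto_integral_of_dominated_convergence (fun w => |Y w - X w|)
      (fun n => ((hmeas n h.aemeasurable_snd).sub
        (hmeas n h.aemeasurable_fst)).aestronglyMeasurable) hint.abs
      (fun n => ae_of_all _ fun w => hφl n _ _) (ae_of_all _ fun w => ?_)
    refine tendsto_const_nhds.congr' ?_
    filter_upwards [hφt (X w), hφt (Y w)] with n h1 h2
    rw [h1, h2]
  simp only [hzero] at hlim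
  exact tendsto_nhds_unique hlim tendsto_const_nhds

lemma lintegral_log_posPart_ne_top [IsProbabilityMeasure μ] {X : Ω → ℝ} {K : ℝ}
    (hK : ∀ w, X w ≤ K) :
    ∫⁻ w, (ENNReal.log (ENNReal.ofReal (X w))).toENNReal ∂μ ≠ ⊤ := by
  refine ne_top_of_le_ne_top
    (b := ∫⁻ _, (ENNReal.log (ENNReal.ofReal K)).toENNReal ∂μ) ?_ (lintegral_mono fun w => ?_)
  · rw [lintegral_const, measure_univ, mul_one]
    rw [Ne, EReal.toENNReal_eq_top_iff, ENNReal.log_eq_top_iff]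
    exact ENNReal.ofReal_ne_top
  · exact EReal.toENNReal_le_toENNReal
      (ENNReal.log_le_log (ENNReal.ofReal_le_ofReal (hK w)))

/-- The upper bound on `X` keeps the positive part finite, so `⊤ - ⊤` cannot occur. -/
lemma expectLog_neg_iff [IsProbabilityMeasure μ] {X : Ω → ℝ} {K : ℝ} (hK : ∀ w, X w ≤ K) :
    expectLog μ X < 0 ↔ ∫⁻ w, (ENNReal.log (ENNReal.ofReal (X w))).toENNReal ∂μ
      < ∫⁻ w, (-ENNReal.log (ENNReal.ofReal (X w))).toENNReal ∂μ := by
  rw [expectLog, EReal.sub_neg, EReal.coe_ennreal_lt_coe_ennreal_iff]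
  · left
    simpa using lintegral_log_posPart_ne_top hK
  · left
    exact EReal.coe_ennreal_ne_bot _

lemma measurable_neg_log_toENNReal {X : Ω → ℝ} (hX : Measurable X) :
    Measurable fun w => (-ENNReal.log (ENNReal.ofReal (X w))).toENNReal :=
  (EReal.continuous_toENNReal.comp (continuous_neg.comp ENNReal.continuous_log)).measurable.comp
    hX.ennreal_ofReal

/-- If the mean of the logarithm is not negative, then it is a genuine integral. -/
lemma integrable_log_of_not_expectLog_neg [IsProbabilityMeasure μ] {X : Ω → ℝ} {K : ℝ}
    (hX : Measurable X) (h0 : ∀ w, 0 ≤ X w) (hK : ∀ w, X w ≤ K) (h : ¬ expectLog μ X < 0) :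
    (∀ᵐ w ∂μ, 0 < X w) ∧ Integrable (fun w => Real.log (X w)) μ ∧
      0 ≤ ∫ w, Real.log (X w) ∂μ := by
  rw [expectLog_neg_iff hK, not_lt] at h
  have hP := lintegral_log_posPart_ne_top (μ := μ) hK
  have hN := ne_top_of_le_ne_top hP h
  have hpos : ∀ᵐ w ∂μ, 0 < X w := by
    -- Where `X = 0` the negative part of the logarithm is `⊤`, which its finite integral excludes
    -- almost surely.
    filter_upwards [ae_lt_top (measurable_neg_log_toENNReal hX) hN] with w hw
    refine (h0 w).lt_of_ne fun h' => hw.ne ?_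
    rw [← h']
    simp
  have e1 : ∫⁻ w, (ENNReal.log (ENNReal.ofReal (X w))).toENNReal ∂μ
      = ∫⁻ w, ENNReal.ofReal (Real.log (X w)) ∂μ :=
    lintegral_congr_ae <| by
      filter_upwards [hpos] with w hw
      rw [ENNReal.log_ofReal_of_pos hw, EReal.real_coe_toENNReal]
  have e2 : ∫⁻ w, (-ENNReal.log (ENNReal.ofReal (X w))).toENNReal ∂μ
      = ∫⁻ w, ENNReal.ofReal (-Real.log (X w)) ∂μ :=
    lintegral_congr_ae <| by
      filter_upwards [hpos] with w hw
      rw [ENNReal.log_ofReal_of_pos hw, ← EReal.coe_neg, EReal.real_coe_toENNReal]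
  rw [e1, e2] at h
  rw [e1] at hP
  rw [e2] at hN
  have hm : Measurable fun w => Real.log (X w) := Real.measurable_log.comp hX
  have hint : Integrable (fun w => Real.log (X w)) μ := by
    refine ⟨hm.aestronglyMeasurable, ?_⟩
    rw [hasFiniteIntegral_iff_norm]
    refine lt_of_le_of_lt (lintegral_mono fun w => ?_)
      ((lintegral_add_left hm.ennreal_ofReal _).trans_lt
        (ENNReal.add_lt_top.2 ⟨hP.lt_top, hN.lt_top⟩))
    rw [Real.norm_eq_abs]
    rcases abs_cases (Real.log (X w)) with ⟨h, _⟩ | ⟨h, _⟩ <;> rw [h]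
    · exact le_self_add
    · exact le_add_self
  refine ⟨hpos, hint, ?_⟩
  rw [integral_eq_lintegral_pos_part_sub_lintegral_neg_part hint, sub_nonneg]
  exact ENNReal.toReal_mono hP h

/-- If the mean of the logarithm is negative, then this persists after a truncation from below. -/
lemma exists_integral_log_max_neg [IsProbabilityMeasure μ] {X : Ω → ℝ} {K : ℝ}
    (hX : Measurable X) (hK : ∀ w, X w ≤ K) (h : expectLog μ X < 0) :
    ∃ δ : ℝ, 0 < δ ∧ Integrable (fun w => Real.log (max (X w) δ)) μ ∧
      ∫ w, Real.log (max (X w) δ) ∂μ < 0 := by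
  rw [expectLog_neg_iff hK] at h
  -- Since `d n ≤ 1`, truncation at `d n` leaves the positive part of the logarithm unchanged. The
  -- negative parts increase to the full one, whose integral may be infinite, so some `n` already
  -- gives a negative mean.
  let d : ℕ → ℝ := fun n => Real.exp (-(n : ℝ))
  have hd : Antitone d := fun m n hmn => Real.exp_le_exp.2 (neg_le_neg (Nat.cast_le.2 hmn))
  have hd0 : Tendsto d atTop (𝓝 0) :=
    Real.tendsto_exp_neg_atTop_nhds_zero.comp tendsto_natCast_atTop_atTop
  have hdpos : ∀ n, 0 < d n := fun n => Real.exp_pos _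
  have hd1 : ∀ n, d n ≤ 1 := fun n => Real.exp_le_one_iff.2 (by simp)
  have hmeas : ∀ n, Measurable fun w => max (X w) (d n) := fun n => hX.max measurable_const
  have hlim : Tendsto
      (fun n => ∫⁻ w, (-ENNReal.log (ENNReal.ofReal (max (X w) (d n)))).toENNReal ∂μ) atTop
      (𝓝 (∫⁻ w, (-ENNReal.log (ENNReal.ofReal (X w))).toENNReal ∂μ)) := by
    refine lintegral_tendsto_of_tendsto_of_monotone
      (fun n => (measurable_neg_log_toENNReal (hmeas n)).aemeasurable)
      (ae_of_all _ fun w m n hmn => ?_) (ae_of_all _ fun w => ?_)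
    · exact EReal.toENNReal_le_toENNReal (EReal.neg_le_neg_iff.2 (ENNReal.log_le_log
        (ENNReal.ofReal_le_ofReal (max_le_max le_rfl (hd hmn)))))
    · have hc : Continuous fun x : ℝ => (-ENNReal.log (ENNReal.ofReal x)).toENNReal :=
        EReal.continuous_toENNReal.comp (continuous_neg.comp
          (ENNReal.continuous_log.comp ENNReal.continuous_ofReal))
      have h1 : Tendsto (fun n => max (X w) (d n)) atTop (𝓝 (max (X w) 0)) :=
        tendsto_const_nhds.max hd0
      have h2 := (hc.tendsto _).comp h1
      have e : ENNReal.ofReal (max (X w) 0) = ENNReal.ofReal (X w) := by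
        rcases le_total (X w) 0 with hw | hw
        · rw [max_eq_right hw, ENNReal.ofReal_of_nonpos hw, ENNReal.ofReal_zero]
        · rw [max_eq_left hw]
      rw [e] at h2
      exact h2
  obtain ⟨n, hn⟩ := (hlim.eventually (lt_mem_nhds h)).exists
  have hpos : ∀ w, 0 < max (X w) (d n) := fun w => (hdpos n).trans_le (le_max_right _ _)
  have hint : Integrable (fun w => Real.log (max (X w) (d n))) μ := by
    refine Integrable.of_mem_Icc (Real.log (d n)) (Real.log (max K (d n)))
      (Real.measurable_log.comp (hmeas n)).aemeasurable (ae_of_all _ fun w => ⟨?_, ?_⟩)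
    · exact Real.log_le_log (hdpos n) (le_max_right _ _)
    · exact Real.log_le_log (hpos w) (max_le_max (hK w) le_rfl)
  refine ⟨d n, hdpos n, hint, ?_⟩
  rw [integral_eq_lintegral_pos_part_sub_lintegral_neg_part hint, sub_neg]
  have e1 : ∫⁻ w, ENNReal.ofReal (Real.log (max (X w) (d n))) ∂μ
      = ∫⁻ w, (ENNReal.log (ENNReal.ofReal (X w))).toENNReal ∂μ :=
    lintegral_congr fun w => by
      rcases le_total (d n) (X w) with hw | hw
      · rw [max_eq_left hw, ENNReal.log_ofReal_of_pos ((hdpos n).trans_le hw),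
          EReal.real_coe_toENNReal]
      · rw [max_eq_right hw, ENNReal.ofReal_of_nonpos
          (Real.log_nonpos (hdpos n).le (hd1 n)), EReal.toENNReal_of_nonpos]
        rw [ENNReal.log_le_zero_iff, ENNReal.ofReal_le_one]
        exact hw.trans (hd1 n)
  have e2 : ∫⁻ w, (-ENNReal.log (ENNReal.ofReal (max (X w) (d n)))).toENNReal ∂μ
      = ∫⁻ w, ENNReal.ofReal (-Real.log (max (X w) (d n))) ∂μ :=
    lintegral_congr fun w => by
      rw [ENNReal.log_ofReal_of_pos (hpos w), ← EReal.coe_neg, EReal.real_coe_toENNReal]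
  rw [e1]
  rw [e2] at hn
  exact ENNReal.toReal_strict_mono (by simpa using hint.neg.lintegral_lt_top.ne) hn

end Log

/-! ### Almost sure contraction and tightness. -/

section Contraction

variable {Ω : Type*} [MeasurableSpace Ω] {μ : Measure Ω}

/-- Products of i.i.d. nonnegative factors with negative mean logarithm decay geometrically. -/
lemma ae_exists_prod_le_pow [IsProbabilityMeasure μ] {X : ℕ → Ω → ℝ} {K : ℝ}
    (hX : ∀ i, Measurable (X i)) (h0 : ∀ i w, 0 ≤ X i w) (hK : ∀ w, X 0 w ≤ K)
    (hind : Pairwise fun i j => IndepFun (X i) (X j) μ)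
    (hid : ∀ i, IdentDistrib (X i) (X 0) μ μ) (h : expectLog μ (X 0) < 0) :
    ∀ᵐ w ∂μ, ∃ ρ : ℝ, 0 ≤ ρ ∧ ρ < 1 ∧
      ∀ᶠ n : ℕ in atTop, ∏ i ∈ Finset.range n, X i w ≤ ρ ^ n := by
  -- The truncation makes the logarithm integrable, as the strong law requires, even if `X` vanishes
  -- with positive probability.
  obtain ⟨δ, hδ, hint, hneg⟩ := exists_integral_log_max_neg (hX 0) hK h
  have hψ : Measurable fun x : ℝ => Real.log (max x δ) := by fun_prop
  have hslln := strong_law_ae_real (μ := μ) (fun i w => Real.log (max (X i w) δ)) hint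
    (fun i j hij => (hind hij).comp hψ hψ) fun i => (hid i).comp hψ
  set m := ∫ w, Real.log (max (X 0 w) δ) ∂μ
  filter_upwards [hslln] with w hw
  -- As `m < m / 2 < 0`, the averages of the logarithms are eventually below `m / 2`.
  refine ⟨Real.exp (m / 2), (Real.exp_pos _).le, by rw [Real.exp_lt_one_iff]; linarith, ?_⟩
  filter_upwards [hw.eventually (gt_mem_nhds (show m < m / 2 by linarith)),
    eventually_gt_atTop 0] with n hn hn0
  have hn0' : (0 : ℝ) < n := Nat.cast_pos.2 hn0
  have hpos : ∀ i, 0 < max (X i w) δ := fun i => hδ.trans_le (le_max_right _ _)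
  calc ∏ i ∈ Finset.range n, X i w ≤ ∏ i ∈ Finset.range n, max (X i w) δ :=
        Finset.prod_le_prod (fun i _ => h0 i w) fun i _ => le_max_left _ _
    _ = Real.exp (∑ i ∈ Finset.range n, Real.log (max (X i w) δ)) := by
        rw [Real.exp_sum]
        exact Finset.prod_congr rfl fun i _ => (Real.exp_log (hpos i)).symm
    _ ≤ Real.exp (n * (m / 2)) :=
        Real.exp_le_exp.2 (by rw [div_lt_iff₀ hn0'] at hn; linarith)
    _ = Real.exp (m / 2) ^ n := Real.exp_nat_mul _ _

/-- A variable dominated by products of a null sequence and a tight sequence vanishes. -/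
lemma ae_eq_zero_of_abs_le_mul [IsFiniteMeasure μ] {Z : Ω → ℝ} {A D : ℕ → Ω → ℝ}
    (hA : ∀ n, Measurable (A n)) (hA0 : ∀ n w, 0 ≤ A n w)
    (hZ : ∀ n, ∀ᵐ w ∂μ, |Z w| ≤ A n w * D n w)
    (hlim : ∀ᵐ w ∂μ, Tendsto (fun n => A n w) atTop (𝓝 0))
    (hD : ∀ θ : ENNReal, 0 < θ → ∃ M : ℝ, 0 < M ∧ ∀ n, μ {w | M < D n w} ≤ θ) :
    ∀ᵐ w ∂μ, Z w = 0 := by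
  have hη : ∀ k : ℕ, ∀ᵐ w ∂μ, |Z w| < 1 / ((k : ℝ) + 1) := by
    intro k
    have hk : (0 : ℝ) < 1 / ((k : ℝ) + 1) := by positivity
    set η := 1 / ((k : ℝ) + 1)
    rw [ae_iff, ← nonpos_iff_eq_zero]
    refine ENNReal.le_of_forall_pos_le_add fun θ hθ _ => ?_
    rw [zero_add]
    -- If `|Z| ≥ η`, then either `D n > M`, of measure at most `θ` uniformly in `n`, or `A n ≥ η /
    -- M`, of measure tending to zero.
    obtain ⟨M, hM, hMD⟩ := hD θ (by exact_mod_cast hθ)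
    have htm := tendstoInMeasure_of_tendsto_ae (μ := μ) (g := fun _ => (0 : ℝ))
      (fun n => (hA n).aestronglyMeasurable) hlim
    have ht := (htm (ENNReal.ofReal (η / M)) (by positivity)).add_const (θ : ENNReal)
    rw [zero_add] at ht
    refine ge_of_tendsto ht (Eventually.of_forall fun n => ?_)
    refine le_trans ?_ (add_le_add le_rfl (hMD n))
    refine (measure_mono_ae ?_).trans (measure_union_le _ _)
    filter_upwards [hZ n] with w hw hw'
    by_cases hDM : M < D n w
    · exact Or.inr hDM
    · left
      have h1 : η ≤ A n w * M :=
        (not_lt.1 hw').trans (hw.trans (mul_le_mul_of_nonneg_left (not_lt.1 hDM) (hA0 n w)))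
      change ENNReal.ofReal (η / M) ≤ edist (A n w) 0
      rw [edist_dist, Real.dist_eq, sub_zero, abs_of_nonneg (hA0 n w)]
      exact ENNReal.ofReal_le_ofReal ((div_le_iff₀ hM).2 h1)
  filter_upwards [ae_all_iff.2 hη] with w hw
  by_contra hne
  obtain ⟨k, hk⟩ := exists_nat_one_div_lt (abs_pos.2 hne)
  exact lt_asymm hk (hw k)

/-- Tightness: equal marginals make the tail bound at time `0` uniform in `t`. Allowing every `M' ≥
M` lets two processes share one level. -/
lemma exists_measure_lt_le_of_map_eq [IsFiniteMeasure μ] {f : ℤ → Ω → ℝ}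
    (hf : ∀ t, Measurable (f t)) (hmap : ∀ s t, μ.map (f s) = μ.map (f t)) {θ : ENNReal}
    (hθ : 0 < θ) : ∃ M : ℝ, ∀ M', M ≤ M' → ∀ t, μ {w | M' < f t w} ≤ θ := by
  have h : Tendsto (fun n : ℕ => μ {w | (n : ℝ) < f 0 w}) atTop (𝓝 0) := by
    have := tendsto_measure_iInter_atTop (μ := μ) (s := fun n : ℕ => {w | (n : ℝ) < f 0 w})
      (fun n => (measurableSet_lt measurable_const (hf 0)).nullMeasurableSet)
      (fun m n hmn w (hw : (n : ℝ) < f 0 w) => (Nat.cast_le.2 hmn).trans_lt hw)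
      ⟨0, measure_ne_top _ _⟩
    have he : ⋂ n : ℕ, {w | (n : ℝ) < f 0 w} = ∅ := by
      ext w
      simp only [Set.mem_iInter, Set.mem_ofPred_eq, Set.mem_empty_iff_false, iff_false, not_forall,
        not_lt]
      exact exists_nat_ge _
    rwa [he, measure_empty] at this
  obtain ⟨n, hn⟩ := (h.eventually (gt_mem_nhds hθ)).exists
  refine ⟨n, fun M' hM' t => ?_⟩
  have e : ∀ t, μ {w | M' < f t w} = μ.map (f t) (Set.Ioi M') := fun t => by
    rw [Measure.map_apply (hf t) measurableSet_Ioi]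
    rfl
  rw [e t, hmap t 0, ← e 0]
  exact (measure_mono fun w (hw : M' < f 0 w) => hM'.trans_lt hw).trans hn.le

lemma IsStationaryErgodic.map_eq {f : ℤ → Ω → ℝ} (hf : IsStationaryErgodic μ f) (s t : ℤ) :
    μ.map (f s) = μ.map (f t) := by
  have hm : Measurable fun w t => f t w := measurable_pi_lambda _ hf.measurable
  have hev : ∀ t, (μ.map fun w t => f t w).map (fun x => x t) = μ.map (f t) := fun t => by
    rw [Measure.map_map (measurable_pi_apply t) hm]
    rfl
  have hstep : ∀ t, μ.map (f (t + 1)) = μ.map (f t) := fun t => by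
    rw [← hev t, ← hf.ergodic.toMeasurePreserving.map_eq,
      Measure.map_map (measurable_pi_apply t) measurable_seqShift,
      Measure.map_map ((measurable_pi_apply t).comp measurable_seqShift) hm]
    rfl
  have hz : ∀ t, μ.map (f t) = μ.map (f 0) := fun t => by
    induction t using Int.induction_on with
    | zero => rfl
    | succ i ih => rw [hstep, ih]
    | pred i ih => rw [← ih, ← hstep (-(i : ℤ) - 1), sub_add_cancel]
  rw [hz s, hz t]

end Contraction

/-! ### The random coefficient and the reduction to an affine recursion. -/

section Coefficient

variable {ω β α γ v : ℝ}

lemma measurable_betaTGarchCoeff (β α γ v : ℝ) : Measurable (betaTGarchCoeff β α γ v) := by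
  have : Measurable leverage := Measurable.ite measurableSet_Iic measurable_const measurable_const
  unfold betaTGarchCoeff
  fun_prop

lemma leverage_coeff_nonneg (hα : 0 < α) (hγ : -α ≤ γ) (e : ℝ) : 0 ≤ α + γ * leverage e := by
  unfold leverage
  split_ifs <;> linarith

lemma betaTGarchCoeff_nonneg (hβ : 0 ≤ β) (hα : 0 < α) (hγ : -α ≤ γ) (hv : 2 < v) (e : ℝ) :
    0 ≤ betaTGarchCoeff β α γ v e := by
  have h1 := leverage_coeff_nonneg hα hγ e
  have h2 : 0 < v + 1 := by linarith
  have h3 : 0 < v - 2 := by linarith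
  unfold betaTGarchCoeff
  positivity

/-- Since `e² / (v - 2 + e²) ≤ 1`, the coefficient is bounded whatever the tails of the noise. -/
lemma betaTGarchCoeff_le (hα : 0 < α) (hγ : -α ≤ γ) (hv : 2 < v) (e : ℝ) :
    betaTGarchCoeff β α γ v e ≤ β + (α + |γ|) * (v + 1) := by
  have h1 := leverage_coeff_nonneg hα hγ e
  have h2 : 0 < v + 1 := by linarith
  have h3 : 0 < v - 2 := by linarith
  have h4 : α + γ * leverage e ≤ α + |γ| := by
    unfold leverage
    split_ifs
    · linarith [le_abs_self γ]
    · linarith [abs_nonneg γ]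
  have h5 : e ^ 2 / (v - 2 + e ^ 2) ≤ 1 := div_le_one_of_le₀ (by linarith) (by positivity)
  unfold betaTGarchCoeff
  have h6 : (α + γ * leverage e) * (v + 1) * (e ^ 2 / (v - 2 + e ^ 2))
      ≤ (α + γ * leverage e) * (v + 1) := mul_le_of_le_one_right (by positivity) h5
  have h7 := mul_le_mul_of_nonneg_right h4 h2.le
  linarith

/-- Driven by `y = √f ε`, the updating equation is affine in `f ≥ 0`. -/
lemma betaTGarchUpdate_sqrt_mul (ω β α γ v e : ℝ) {f : ℝ} (hf : 0 ≤ f) :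
    betaTGarchUpdate ω β α γ v f (Real.sqrt f * e) = ω + betaTGarchCoeff β α γ v e * f := by
  rcases hf.eq_or_lt with rfl | hf
  -- At `f = 0` the observation is `0`, so the numerator vanishes and the default value of `y² / 0`
  -- is harmless.
  · simp [betaTGarchUpdate]
  · have hl : leverage (Real.sqrt f * e) = leverage e := by
      have : Real.sqrt f * e ≤ 0 ↔ e ≤ 0 := mul_nonpos_iff_pos_imp_nonpos.trans
        ⟨fun h => h.1 (Real.sqrt_pos.2 hf), fun h => ⟨fun _ => h, fun _ => Real.sqrt_nonneg f⟩⟩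
      simp only [leverage, this]
    rw [betaTGarchUpdate, betaTGarchCoeff, hl, mul_pow, Real.sq_sqrt hf.le,
      mul_div_cancel_left₀ _ hf.ne']
    ring

end Coefficient

/-! ### The affine recursion and its series solution. -/

section Recursion

/-- The product of `c` over the `k` times that precede `t`. -/
noncomputable def pastProd (c : ℤ → ℝ) (t : ℤ) (k : ℕ) : ℝ :=
  ∏ i ∈ Finset.range k, c (t - 1 - i)

/-- The solution `ω ∑ₖ c_{t-1} ⋯ c_{t-k}` of the affine recursion `f_{t+1} = ω + c_t f_t`. -/
noncomputable def affineSolution (ω : ℝ) (c : ℤ → ℝ) (t : ℤ) : ℝ :=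
  ω * ∑' k, pastProd c t k

lemma pastProd_zero (c : ℤ → ℝ) (t : ℤ) : pastProd c t 0 = 1 := by simp [pastProd]

lemma pastProd_succ (c : ℤ → ℝ) (t : ℤ) (k : ℕ) :
    pastProd c t (k + 1) = pastProd c t k * c (t - 1 - k) := Finset.prod_range_succ _ _

lemma pastProd_add_one_succ (c : ℤ → ℝ) (t : ℤ) (k : ℕ) :
    pastProd c (t + 1) (k + 1) = c t * pastProd c t k := by
  rw [pastProd, pastProd, Finset.prod_range_succ', mul_comm]
  congr 1
  · congr 1
    simp
  · refine Finset.prod_congr rfl fun i _ => ?_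
    congr 1
    push_cast
    ring

lemma pastProd_nonneg {c : ℤ → ℝ} (hc : ∀ t, 0 ≤ c t) (t : ℤ) (k : ℕ) : 0 ≤ pastProd c t k :=
  Finset.prod_nonneg fun _ _ => hc _

lemma affineSolution_nonneg {ω : ℝ} {c : ℤ → ℝ} (hω : 0 ≤ ω) (hc : ∀ t, 0 ≤ c t) (t : ℤ) :
    0 ≤ affineSolution ω c t :=
  mul_nonneg hω (tsum_nonneg fun k => pastProd_nonneg hc t k)

/-- The term `k = 0` gives `ω`, and every later term contains the factor `c t`. Summability rules
out the default value `0` of a divergent sum. -/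
lemma affineSolution_add_one {ω : ℝ} {c : ℤ → ℝ} {t : ℤ} (h : Summable (pastProd c t)) :
    affineSolution ω c (t + 1) = ω + c t * affineSolution ω c t := by
  have h1 : Summable fun k => pastProd c (t + 1) (k + 1) := by
    simp only [pastProd_add_one_succ]
    exact h.mul_left _
  rw [affineSolution, affineSolution, ((summable_nat_add_iff 1).1 h1).tsum_eq_zero_add,
    pastProd_zero]
  simp only [pastProd_add_one_succ]
  rw [tsum_mul_left]
  ring

/-- This equivariance lets the solution inherit stationarity and ergodicity from the noise. -/
lemma affineSolution_comp_add_one (ω : ℝ) (c : ℤ → ℝ) (t : ℤ) :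
    affineSolution ω (fun s => c (s + 1)) t = affineSolution ω c (t + 1) := by
  unfold affineSolution pastProd
  congr 2
  funext k
  exact Finset.prod_congr rfl fun i _ => congrArg c (by ring)

/-- Two solutions of the affine recursion differ by a multiple of the past products. -/
lemma sub_eq_pastProd_mul {ω : ℝ} {c f g : ℤ → ℝ} (hf : ∀ t, f (t + 1) = ω + c t * f t)
    (hg : ∀ t, g (t + 1) = ω + c t * g t) (t : ℤ) (n : ℕ) :
    g t - f t = pastProd c t n * (g (t - n) - f (t - n)) := by
  induction n with
  | zero => simp [pastProd_zero]
  | succ n ih =>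
    have e : t - n = t - 1 - n + 1 := by ring
    have e' : t - (n + 1 : ℕ) = t - 1 - n := by push_cast; ring
    rw [ih, pastProd_succ, e', e, hf, hg]
    ring

lemma measurable_pastProd {S : Type*} [MeasurableSpace S] {c : S → ℤ → ℝ}
    (hc : ∀ t, Measurable fun x => c x t) (t : ℤ) (k : ℕ) :
    Measurable fun x => pastProd (c x) t k :=
  Finset.measurable_fun_prod _ fun _ _ => hc _

lemma measurable_affineSolution {S : Type*} [MeasurableSpace S] {c : S → ℤ → ℝ} (ω : ℝ)
    (hc : ∀ t, Measurable fun x => c x t) (h0 : ∀ x t, 0 ≤ c x t) (t : ℤ) :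
    Measurable fun x => affineSolution ω (c x) t := by
  -- Sums in `ENNReal` are measurable without summability, and `toReal ⊤ = 0` matches the default
  -- value of a divergent real sum.
  have e : ∀ x, ∑' k, pastProd (c x) t k
      = (∑' k, ENNReal.ofReal (pastProd (c x) t k)).toReal := fun x => by
    rw [ENNReal.tsum_toReal_eq fun _ => ENNReal.ofReal_ne_top]
    exact tsum_congr fun k => (ENNReal.toReal_ofReal (pastProd_nonneg (h0 x) t k)).symm
  unfold affineSolution
  simp only [e]
  exact ((Measurable.tsum fun k => (measurable_pastProd hc t k).ennreal_ofReal).ennreal_toReal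
    ).const_mul ω

end Recursion

/-! ### The two implications for the model. -/

section Model

variable {Ω : Type*} [MeasurableSpace Ω] {μ : Measure Ω} {ω β α γ v s : ℝ} {ε : ℤ → Ω → ℝ}

lemma IsBetaTGarchSolution.ae_affine {f : ℤ → Ω → ℝ}
    (hf : IsBetaTGarchSolution μ ω β α γ v ε f) :
    ∀ᵐ w ∂μ, ∀ t, f (t + 1) w = ω + betaTGarchCoeff β α γ v (ε t w) * f t w := by
  filter_upwards [ae_all_iff.2 hf.nonneg, ae_all_iff.2 hf.update] with w h0 hu t
  rw [hu t, betaTGarchUpdate_sqrt_mul _ _ _ _ _ _ (h0 t)]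

lemma IsIIDStudentT.identDistrib (hε : IsIIDStudentT μ v s ε) (t t' : ℤ) :
    IdentDistrib (ε t) (ε t') μ μ :=
  ⟨(hε.measurable t).aemeasurable, (hε.measurable t').aemeasurable,
    (hε.law t).trans (hε.law t').symm⟩

lemma ProbabilityTheory.IdentDistrib.expectLog_eq {X Y : Ω → ℝ}
    (h : IdentDistrib X Y μ μ) : expectLog μ X = expectLog μ Y := by
  have hl : Measurable fun x : ℝ => ENNReal.log (ENNReal.ofReal x) :=
    ENNReal.measurable_log.comp ENNReal.measurable_ofReal
  have h1 : Measurable fun x : ℝ => (ENNReal.log (ENNReal.ofReal x)).toENNReal :=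
    EReal.continuous_toENNReal.measurable.comp hl
  have h2 : Measurable fun x : ℝ => (-ENNReal.log (ENNReal.ofReal x)).toENNReal :=
    EReal.continuous_toENNReal.measurable.comp (continuous_neg.measurable.comp hl)
  have e1 := (h.comp h1).lintegral_eq
  have e2 := (h.comp h2).lintegral_eq
  simp only [Function.comp_def] at e1 e2
  rw [expectLog, expectLog, e1, e2]

/-- An equivariant measurable function of an i.i.d. sequence is stationary and ergodic. -/
lemma IsIIDStudentT.isStationaryErgodic_comp [IsProbabilityMeasure μ]
    (hε : IsIIDStudentT μ v s ε) {Φ : (ℤ → ℝ) → ℤ → ℝ} (hΦ : ∀ t, Measurable fun x => Φ x t)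
    (hcomm : ∀ x, Φ (seqShift x) = seqShift (Φ x)) :
    IsStationaryErgodic μ fun t w => Φ (fun i => ε i w) t := by
  have hm : Measurable fun w t => ε t w := measurable_pi_lambda _ hε.measurable
  have hΦ' : Measurable Φ := measurable_pi_lambda _ hΦ
  have := Measure.isProbabilityMeasure_map (μ := μ) (hε.measurable 0).aemeasurable
  have herg : Ergodic seqShift (μ.map fun w t => ε t w) := by
    rw [hε.indep.map_fun_eq_infinitePi_map hε.measurable]
    simp only [fun t => (hε.identDistrib t 0).map_eq]
    exact ergodic_seqShift_infinitePi _
  refine ⟨fun t => (hΦ t).comp hm, ?_⟩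
  -- `Φ` is a factor map from the noise to the process, and ergodicity passes to factors.
  have hmp : MeasurePreserving Φ (μ.map fun w t => ε t w)
      (μ.map fun w t => Φ (fun i => ε i w) t) :=
    ⟨hΦ', by rw [Measure.map_map hΦ' hm]; rfl⟩
  exact hmp.ergodic_of_ergodic_semiconj herg measurable_seqShift hcomm

/-- If the mean logarithm is negative, then the past products decay geometrically. -/
lemma IsIIDStudentT.ae_exists_pastProd_le_pow [IsProbabilityMeasure μ]
    (hε : IsIIDStudentT μ v s ε) (hβ : 0 ≤ β) (hα : 0 < α) (hγ : -α ≤ γ) (hv : 2 < v) (t₀ : ℤ)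
    (h : expectLog μ (fun w => betaTGarchCoeff β α γ v (ε t₀ w)) < 0) :
    ∀ᵐ w ∂μ, ∀ t, ∃ ρ : ℝ, 0 ≤ ρ ∧ ρ < 1 ∧ ∀ᶠ n : ℕ in atTop,
      pastProd (fun i => betaTGarchCoeff β α γ v (ε i w)) t n ≤ ρ ^ n := by
  have hc := measurable_betaTGarchCoeff β α γ v
  refine ae_all_iff.2 fun t => ?_
  refine ae_exists_prod_le_pow (X := fun (i : ℕ) w => betaTGarchCoeff β α γ v (ε (t - 1 - i) w))
    (K := β + (α + |γ|) * (v + 1)) (fun i => hc.comp (hε.measurable _))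
    (fun i w => betaTGarchCoeff_nonneg hβ hα hγ hv _)
    (fun w => betaTGarchCoeff_le hα hγ hv _) (fun i j hij => ?_)
    (fun i => (hε.identDistrib _ _).comp hc) ?_
  · refine (hε.indep.indepFun ?_).comp hc hc
    omega
  · exact ((hε.identDistrib (t - 1 - (0 : ℕ)) t₀).comp hc).expectLog_eq.trans_lt h

/-- A negative mean logarithm yields a stationary ergodic solution, unique almost surely. -/
theorem exists_unique_solution_of_expectLog_neg [IsProbabilityMeasure μ]
    (hω : 0 < ω) (hβ : 0 ≤ β) (hα : 0 < α) (hγ : -α ≤ γ) (hv : 2 < v)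
    (hε : IsIIDStudentT μ v s ε) (t₀ : ℤ)
    (h : expectLog μ (fun w => betaTGarchCoeff β α γ v (ε t₀ w)) < 0) :
    ∃ f : ℤ → Ω → ℝ,
      (IsBetaTGarchSolution μ ω β α γ v ε f ∧ IsStationaryErgodic μ f) ∧
      ∀ g : ℤ → Ω → ℝ, IsBetaTGarchSolution μ ω β α γ v ε g ∧ IsStationaryErgodic μ g →
        ∀ᵐ w ∂μ, ∀ t, g t w = f t w := by
  have hc := measurable_betaTGarchCoeff β α γ v
  have hc0 : ∀ e, 0 ≤ betaTGarchCoeff β α γ v e := betaTGarchCoeff_nonneg hβ hα hγ hv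
  have hdecay := hε.ae_exists_pastProd_le_pow hβ hα hγ hv t₀ h
  let Φ : (ℤ → ℝ) → ℤ → ℝ := fun e => affineSolution ω fun i => betaTGarchCoeff β α γ v (e i)
  let f : ℤ → Ω → ℝ := fun t w => Φ (fun i => ε i w) t
  have hf0 : ∀ t w, 0 ≤ f t w := fun t w => affineSolution_nonneg hω.le (fun _ => hc0 _) t
  have hfsol : IsBetaTGarchSolution μ ω β α γ v ε f := by
    refine ⟨fun t => ae_of_all _ (hf0 t), fun t => ?_⟩
    filter_upwards [hdecay] with w hw
    rw [betaTGarchUpdate_sqrt_mul _ _ _ _ _ _ (hf0 t w)]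
    obtain ⟨ρ, hρ0, hρ1, hρ⟩ := hw t
    refine affineSolution_add_one (c := fun i => betaTGarchCoeff β α γ v (ε i w)) ?_
    refine Summable.of_norm_bounded_eventually_nat (summable_geometric_of_lt_one hρ0 hρ1) ?_
    filter_upwards [hρ] with n hn
    rwa [Real.norm_of_nonneg (pastProd_nonneg (fun _ => hc0 _) t n)]
  have hfse : IsStationaryErgodic μ f :=
    hε.isStationaryErgodic_comp
      (fun t => measurable_affineSolution ω (fun i => hc.comp (measurable_pi_apply i))
        (fun _ _ => hc0 _) t)
      fun x => funext fun t => 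
        affineSolution_comp_add_one ω (fun i => betaTGarchCoeff β α γ v (x i)) t
  refine ⟨f, ⟨hfsol, hfse⟩, fun g ⟨hgsol, hgse⟩ => ae_all_iff.2 fun t => ?_⟩
  -- By nonnegativity `|g - f| ≤ g + f` at time `t - n`. This bound is tight: a sum above `2M` has a
  -- term above `M`, and each term gets `θ / 2`.
  have hz : ∀ᵐ w ∂μ, g t w - f t w = 0 := by
    refine ae_eq_zero_of_abs_le_mul
      (A := fun n w => pastProd (fun i => betaTGarchCoeff β α γ v (ε i w)) t n)
      (D := fun n w => g (t - n) w + f (t - n) w)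
      (fun n => measurable_pastProd (fun i => hc.comp (hε.measurable i)) t n)
      (fun n w => pastProd_nonneg (fun _ => hc0 _) t n) (fun n => ?_) ?_ fun θ hθ => ?_
    · filter_upwards [hfsol.ae_affine, hgsol.ae_affine, hgsol.nonneg (t - n)] with w hfw hgw hg0
      have hA := pastProd_nonneg (c := fun i => betaTGarchCoeff β α γ v (ε i w))
        (fun _ => hc0 _) t n
      rw [sub_eq_pastProd_mul (f := fun t => f t w) (g := fun t => g t w)
        (c := fun i => betaTGarchCoeff β α γ v (ε i w)) hfw hgw t n, abs_mul, abs_of_nonneg hA]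
      refine mul_le_mul_of_nonneg_left (abs_le.2 ⟨?_, ?_⟩) hA <;> linarith [hf0 (t - n) w]
    · filter_upwards [hdecay] with w hw
      obtain ⟨ρ, hρ0, hρ1, hρ⟩ := hw t
      exact squeeze_zero' (Eventually.of_forall fun n => pastProd_nonneg (fun _ => hc0 _) t n) hρ
        (tendsto_pow_atTop_nhds_zero_of_lt_one hρ0 hρ1)
    · obtain ⟨M₁, h₁⟩ := exists_measure_lt_le_of_map_eq hgse.measurable hgse.map_eq
        (ENNReal.half_pos hθ.ne')
      obtain ⟨M₂, h₂⟩ := exists_measure_lt_le_of_map_eq hfse.measurable hfse.map_eq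
        (ENNReal.half_pos hθ.ne')
      let M := max (max M₁ M₂) 1
      have hM : 0 < M := lt_of_lt_of_le one_pos (le_max_right _ _)
      refine ⟨M + M, by positivity, fun n => ?_⟩
      calc μ {w | M + M < g (t - n) w + f (t - n) w}
          ≤ μ ({w | M < g (t - n) w} ∪ {w | M < f (t - n) w}) :=
            measure_mono fun w (hw : M + M < g (t - n) w + f (t - n) w) => lt_or_lt_of_add_lt_add hw
        _ ≤ θ / 2 + θ / 2 := (measure_union_le _ _).trans (add_le_add
            (h₁ M ((le_max_left _ _).trans (le_max_left _ _)) _)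
            (h₂ M ((le_max_right _ _).trans (le_max_left _ _)) _))
        _ = θ := ENNReal.add_halves θ
  filter_upwards [hz] with w hw
  exact sub_eq_zero.1 hw

/-- A stationary solution forces the mean logarithm of the coefficient to be negative, since
`log f_{t+1} - log f_t` has mean zero and exceeds `log c_t`. -/
theorem expectLog_neg_of_stationary_solution [IsProbabilityMeasure μ]
    (hω : 0 < ω) (hβ : 0 ≤ β) (hα : 0 < α) (hγ : -α ≤ γ) (hv : 2 < v)
    (hε : ∀ t, Measurable (ε t)) (t₀ : ℤ) {f : ℤ → Ω → ℝ}
    (hf : IsBetaTGarchSolution μ ω β α γ v ε f) (hse : IsStationaryErgodic μ f) :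
    expectLog μ (fun w => betaTGarchCoeff β α γ v (ε t₀ w)) < 0 := by
  by_contra hneg
  have hc0 : ∀ e, 0 ≤ betaTGarchCoeff β α γ v e := betaTGarchCoeff_nonneg hβ hα hγ hv
  have hcm : Measurable fun w => betaTGarchCoeff β α γ v (ε t₀ w) :=
    (measurable_betaTGarchCoeff β α γ v).comp (hε t₀)
  set K := β + (α + |γ|) * (v + 1)
  have hcK : ∀ w, betaTGarchCoeff β α γ v (ε t₀ w) ≤ K := fun w => betaTGarchCoeff_le hα hγ hv _
  obtain ⟨hpos, hint, hmean⟩ :=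
    integrable_log_of_not_expectLog_neg hcm (fun w => hc0 _) hcK hneg
  set c : Ω → ℝ := fun w => betaTGarchCoeff β α γ v (ε t₀ w)
  have hid : IdentDistrib (fun w => Real.log (f t₀ w)) (fun w => Real.log (f (t₀ + 1) w)) μ μ :=
    IdentDistrib.comp ⟨(hse.measurable _).aemeasurable, (hse.measurable _).aemeasurable,
      hse.map_eq _ _⟩ Real.measurable_log
  -- The ratio `f_{t+1} / f_t = ω / f_t + c_t` exceeds `c_t` and is at most `1 + K`, because the
  -- equation at `t₀ - 1` gives `f_t ≥ ω`.
  have hbounds : ∀ᵐ w ∂μ, Real.log (c w) < Real.log (f (t₀ + 1) w) - Real.log (f t₀ w) ∧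
      Real.log (f (t₀ + 1) w) - Real.log (f t₀ w) ≤ Real.log (K + 1) := by
    filter_upwards [hf.ae_affine, hf.nonneg (t₀ - 1), hpos] with w hw h0 hcw
    have hge : ω ≤ f t₀ w := by
      have := hw (t₀ - 1)
      rw [sub_add_cancel] at this
      rw [this]
      exact le_add_of_nonneg_right (mul_nonneg (hc0 _) h0)
    have hfp : 0 < f t₀ w := hω.trans_le hge
    have hwp : 0 < ω / f t₀ w := div_pos hω hfp
    have e : f (t₀ + 1) w = (ω / f t₀ w + c w) * f t₀ w := by
      rw [hw t₀, add_mul, div_mul_cancel₀ _ hfp.ne']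
    have e' : Real.log (f (t₀ + 1) w) - Real.log (f t₀ w) = Real.log (ω / f t₀ w + c w) := by
      rw [e, Real.log_mul (by positivity) hfp.ne', add_sub_cancel_right]
    rw [e']
    refine ⟨Real.log_lt_log hcw (by linarith), Real.log_le_log (by positivity) ?_⟩
    linarith [hcK w, (div_le_one hfp).2 hge]
  -- Only the increment is shown to be integrable; `log f` itself need not be.
  have hdiff : Integrable (fun w => Real.log (f (t₀ + 1) w) - Real.log (f t₀ w)) μ := by
    refine Integrable.mono' (hint.abs.add (integrable_const |Real.log (K + 1)|))
      (hid.aemeasurable_snd.sub hid.aemeasurable_fst).aestronglyMeasurable ?_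
    filter_upwards [hbounds] with w hw
    rw [Real.norm_eq_abs, abs_le, Pi.add_apply]
    constructor <;> linarith [neg_abs_le (Real.log (c w)), le_abs_self (Real.log (K + 1)),
      abs_nonneg (Real.log (c w)), abs_nonneg (Real.log (K + 1)), hw.1, hw.2]
  have hzero := integral_sub_eq_zero_of_identDistrib hid hdiff
  -- The integrand is almost surely positive, yet its mean is `0 - E log c ≤ 0`.
  have hgap : ∫ w, (Real.log (f (t₀ + 1) w) - Real.log (f t₀ w) - Real.log (c w)) ∂μ = 0 :=
    le_antisymm (by rw [integral_sub hdiff hint]; linarith)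
      (integral_nonneg_of_ae (hbounds.mono fun w hw => sub_nonneg.2 hw.1.le))
  rw [integral_eq_zero_iff_of_nonneg_ae (hbounds.mono fun w hw => sub_nonneg.2 hw.1.le)
    (hdiff.sub hint)] at hgap
  have hfalse : ∀ᵐ _ ∂μ, False := by
    filter_upwards [hgap, hbounds] with w h1 h2
    exact (sub_pos.2 h2.1).ne' h1
  exact hfalse.exists.choose_spec

end Model

theorem theorem4 {Ω : Type*} [MeasurableSpace Ω] (μ : Measure Ω) [IsProbabilityMeasure μ]
    (ω β α γ v s : ℝ) (hω : 0 < ω) (hβ : 0 ≤ β) (hα : 0 < α) (hγ : -α ≤ γ) (hv : 2 < v)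
    (hs : 0 < s) (ε : ℤ → Ω → ℝ) (hε : IsIIDStudentT μ v s ε) (t₀ : ℤ) :
    (∃ f : ℤ → Ω → ℝ,
      (IsBetaTGarchSolution μ ω β α γ v ε f ∧ IsStationaryErgodic μ f) ∧
      ∀ g : ℤ → Ω → ℝ, IsBetaTGarchSolution μ ω β α γ v ε g ∧ IsStationaryErgodic μ g →
        ∀ᵐ w ∂μ, ∀ t, g t w = f t w) ↔
    expectLog μ (fun w => betaTGarchCoeff β α γ v (ε t₀ w)) < 0 := by
  refine ⟨fun ⟨f, ⟨hf, hse⟩, _⟩ => ?_, fun h => ?_⟩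
  · exact expectLog_neg_of_stationary_solution hω hβ hα hγ hv hε.measurable t₀ hf hse
  · exact exists_unique_solution_of_expectLog_neg hω hβ hα hγ hv hε t₀ h
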